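/- Let $\mathbb{D}$ be the open unit disc, let $dA$ be normalized Lebesgue measure on $\mathbb{D}$, and let $u\in L^1(\mathbb{D},dA)$ with $u>0$ almost everywhere. Suppose that $u$ satisfies the Bekollé–Bonami condition $B_2$: there is a constant $C>0$ such that $$\frac{1}{A(S(I))^2}\int_{S(I)}u\,dA\int_{S(I)}\frac1u\,dA\le C$$ for every arc $I\subset\partial\mathbb{D}$ of length $0<|I|\le 2\pi$, where $S(I)=\{re^{it}: e^{it}\in I,\ 1-\frac{|I|}{2\pi}\le r<1\}$. Put $d\mu=u\,dA$, and let $A^2(u)$ be the space of analytic functions $f$ on $\mathbb{D}$ with $\|f\|_{A^2(u)}^2=\int_{\mathbb{D}}|f|^2u\,dA<\infty$. For $a\in\mathbb{D}$ let $B_a(z)=(1-\overline{a}z)^{-2}$. Let $\nu$ be a positive Borel measure on $\mathbb{D}$ with Berezin transform $$\tilde\nu(a)=\frac{1}{\|B_a\|_{A^2(u)}^2}\int_{\mathbb{D}}|B_a(z)|^2\,d\nu(z),\qquad a\in\mathbb{D}.$$ If $\tilde\nu$ is bounded on $\mathbb{D}$, then $\nu$ is a $\mu$-Carleson measure for $A^2(u)$: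 there is a constant $C'>0$ such that $$\int_{\mathbb{D}}|f|^2\,d\nu\le C'\int_{\mathbb{D}}|f|^2\,d\mu$$ for every $f\in A^2(u)$ (in particular, for every polynomial $f$). -/

import Mathlib

open MeasureTheory
open scoped ENNReal NNReal ComplexConjugate

noncomputable section

namespace WeightedBergman

/-- The open unit disc of the complex plane. -/
def disc : Set ℂ := Metric.ball 0 1

/-- The normalized Lebesgue measure `dA` of the unit disc, as a measure on `ℂ`
that gives no mass to the complement of the disc. -/
def area : Measure ℂ := ENNReal.ofReal (1 / Real.pi) • volume.restrict disc

/-- The measure `dμ = u dA`. -/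
def weightedArea (u : ℂ → ℝ) : Measure ℂ :=
  area.withDensity fun z => ENNReal.ofReal (u z)

/-- The Carleson square `S(I)` over the arc `I = {e^{it} : θ ≤ t ≤ θ + ℓ}` of length `ℓ`. -/
def carlesonSquare (θ ℓ : ℝ) : Set ℂ :=
  {z | ∃ r t : ℝ, t ∈ Set.Icc θ (θ + ℓ) ∧ 1 - ℓ / (2 * Real.pi) ≤ r ∧ r < 1 ∧
    z = (r : ℂ) * Complex.exp ((t : ℂ) * Complex.I)}

/-- The Bekollé-Bonami condition `B₂`, over all arcs of the circle (lengths `0 < ℓ ≤ 2π`). -/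
def BekolleBonami (u : ℂ → ℝ) : Prop :=
  ∃ C : ℝ≥0, ∀ θ ℓ : ℝ, 0 < ℓ → ℓ ≤ 2 * Real.pi →
    (∫⁻ z in carlesonSquare θ ℓ, ENNReal.ofReal (u z) ∂area) *
        (∫⁻ z in carlesonSquare θ ℓ, (ENNReal.ofReal (u z))⁻¹ ∂area) /
      area (carlesonSquare θ ℓ) ^ 2 ≤ C

/-- The square of the `A²(u)` norm, as an extended nonnegative number. -/
def normSq (u : ℂ → ℝ) (f : ℂ → ℂ) : ℝ≥0∞ :=
  ∫⁻ z, ‖f z‖ₑ ^ 2 ∂(weightedArea u)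

/-- Membership in the weighted Bergman space `A²(u)`. -/
def MemBergman (u : ℂ → ℝ) (f : ℂ → ℂ) : Prop :=
  AnalyticOnNhd ℂ f disc ∧ normSq u f < ∞

/-- The Bergman kernel `B_a(z) = 1 / (1 - conj a * z) ^ 2`. -/
def bergmanKernel (a z : ℂ) : ℂ := 1 / (1 - conj a * z) ^ 2

/-- The Berezin transform of `ν`: the integral of `|B_a|²` with respect to `ν`, divided by
the squared norm of `B_a` in `A²(u)`. -/
def berezin (u : ℂ → ℝ) (ν : Measure ℂ) (a : ℂ) : ℝ≥0∞ :=
  (∫⁻ z, ‖bergmanKernel a z‖ₑ ^ 2 ∂ν) / normSq u (bergmanKernel a)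

/-- `ν` is a `μ`-Carleson measure for `A²(u)`, where `dμ = u dA`. -/
def IsCarlesonMeasure (u : ℂ → ℝ) (ν : Measure ℂ) : Prop :=
  ∃ C : ℝ≥0, 0 < C ∧ ∀ f : ℂ → ℂ, MemBergman u f →
    ∫⁻ z, ‖f z‖ₑ ^ 2 ∂ν ≤ C * ∫⁻ z, ‖f z‖ₑ ^ 2 ∂(weightedArea u)

/-- For an integrable weight all polynomials belong to `A²(u)`. -/
theorem memBergman_polynomial {u : ℂ → ℝ} (hu : Integrable u area) (p : Polynomial ℂ) :
    MemBergman u (fun z => p.eval z) := by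
  have hd : Differentiable ℂ fun z => p.eval z := p.differentiable
  refine ⟨fun z _ => hd.analyticAt z, ?_⟩
  obtain ⟨K, hK⟩ := (isCompact_closedBall (0 : ℂ) 1).exists_bound_of_continuousOn
    (f := fun z => p.eval z) (by fun_prop)
  have hfin : weightedArea u Set.univ < ∞ := by
    rw [weightedArea, withDensity_apply _ MeasurableSet.univ, Measure.restrict_univ]
    exact hu.lintegral_lt_top
  have hae : ∀ᵐ z ∂(weightedArea u), ‖p.eval z‖ₑ ^ 2 ≤ (ENNReal.ofReal K) ^ 2 := by
    refine (withDensity_absolutelyContinuous _ _).ae_le ?_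
    refine Measure.ae_smul_measure ?_ _
    filter_upwards [ae_restrict_mem Metric.isOpen_ball.measurableSet] with z hz
    gcongr
    rw [← ofReal_norm]
    exact ENNReal.ofReal_le_ofReal (hK z (Metric.ball_subset_closedBall hz))
  calc normSq u (fun z => p.eval z) ≤ ∫⁻ _, (ENNReal.ofReal K) ^ 2 ∂(weightedArea u) :=
        lintegral_mono_ae hae
    _ < ∞ := by
        rw [lintegral_const]
        exact ENNReal.mul_lt_top (ENNReal.pow_lt_top ENNReal.ofReal_lt_top) hfin

/-- A `μ`-Carleson measure satisfies the Carleson inequality for all polynomials. -/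
theorem IsCarlesonMeasure.polynomial {u : ℂ → ℝ} {ν : Measure ℂ} (hu : Integrable u area)
    (h : IsCarlesonMeasure u ν) :
    ∃ C : ℝ≥0, 0 < C ∧ ∀ p : Polynomial ℂ,
      ∫⁻ z, ‖p.eval z‖ₑ ^ 2 ∂ν ≤ C * ∫⁻ z, ‖p.eval z‖ₑ ^ 2 ∂(weightedArea u) :=
  let ⟨C, hC, hf⟩ := h
  ⟨C, hC, fun p => hf _ (memBergman_polynomial hu p)⟩

end WeightedBergman

end

namespace WeightedBergman

/-! Write σ for u⁻¹ dA and h = 1 - |a|. Applying Cauchy-Schwarz to the area mean value property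
gives |f(a)|² ≤ 16 h⁻⁴ σ(D(a, h/2)) ∫_{D(a, h/2)} |f|² dμ. Integrated against ν and combined with
Tonelli, this reduces the claim to ν(D(z, 1-|z|)) σ(D(z, 2(1-|z|))) ≲ (1-|z|)⁴. Since |B_z|² ≳
(1-|z|)⁻⁴ on D(z, 1-|z|), the bounded Berezin transform yields ν(D(z, 1-|z|)) ≲ (1-|z|)⁴ ‖B_z‖², so
it suffices that ‖B_a‖² σ(D(a, 2h)) is bounded (`exists_normSq_bergmanKernel_mul_dualArea_le`).

For that bound, let ζ be a point of the circle nearest to a. Dyadic discs D_k = D(ζ, 2^k·4h) give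
‖B_a‖² ≲ ∑ μ(D_k)(2^k h)⁻⁴. The B₂ condition gives only μ(D_k) ≲ (2^k h)⁴/σ(D_k), whose sum
converges once σ(D_k) grows geometrically. This reverse doubling (`dualArea_ball_half_le`) also
comes from B₂, and `chain_le` handles the scales beyond the size of 𝔻. -/

/-- The measure `u⁻¹ dA`. -/
noncomputable def dualArea (u : ℂ → ℝ) : Measure ℂ :=
  area.withDensity fun z => (ENNReal.ofReal (u z))⁻¹

/-! ### Areas of discs, and duality between u and u⁻¹. -/

theorem area_apply {s : Set ℂ} (hs : MeasurableSet s) :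
    area s = ENNReal.ofReal (1 / Real.pi) * volume (s ∩ disc) := by
  simp [area, Measure.restrict_apply hs]

theorem coe_nnreal_pi : (NNReal.pi : ℝ≥0∞) = ENNReal.ofReal Real.pi := by
  rw [ENNReal.ofReal, ← NNReal.coe_real_pi, Real.toNNReal_coe]

theorem area_ball {c : ℂ} {r : ℝ} (h : Metric.ball c r ⊆ disc) :
    area (Metric.ball c r) = ENNReal.ofReal r ^ 2 := by
  rw [area_apply measurableSet_ball, Set.inter_eq_left.2 h, Complex.volume_ball, mul_comm,
    mul_assoc]
  rw [coe_nnreal_pi, ← ENNReal.ofReal_mul Real.pi_pos.le, mul_one_div_cancel Real.pi_ne_zero]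
  simp

theorem area_closedBall_le (c : ℂ) (r : ℝ) :
    area (Metric.closedBall c r) ≤ ENNReal.ofReal r ^ 2 := by
  rw [area_apply measurableSet_closedBall]
  calc _ ≤ ENNReal.ofReal (1 / Real.pi) * volume (Metric.closedBall c r) := by
        gcongr; exact Set.inter_subset_left
    _ = _ := by
        rw [Complex.volume_closedBall, mul_comm, mul_assoc, coe_nnreal_pi,
          ← ENNReal.ofReal_mul Real.pi_pos.le, mul_one_div_cancel Real.pi_ne_zero]
        simp

theorem area_compl_disc : area discᶜ = 0 := by
  rw [area_apply (show MeasurableSet disc from measurableSet_ball).compl]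
  simp

theorem weightedArea_compl_disc (u : ℂ → ℝ) : weightedArea u discᶜ = 0 :=
  withDensity_absolutelyContinuous _ _ area_compl_disc

theorem dualArea_compl_disc (u : ℂ → ℝ) : dualArea u discᶜ = 0 :=
  withDensity_absolutelyContinuous _ _ area_compl_disc

/-- Discs centred on the unit circle protrude from 𝔻; only their traces on 𝔻 carry mass. -/
theorem measure_le_of_inter_disc_subset {μ : Measure ℂ} (hμ : μ discᶜ = 0) {s t : Set ℂ}
    (h : s ∩ disc ⊆ t) : μ s ≤ μ t := by
  refine measure_mono_ae ?_
  have : ∀ᵐ z ∂μ, z ∈ disc := by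
    rw [ae_iff]; exact hμ
  filter_upwards [this] with z hz hs
  exact h ⟨hs, hz⟩

theorem sq_lintegral_mul_le {α : Type*} [MeasurableSpace α] (μ : Measure α) {f g : α → ℝ≥0∞}
    (hf : AEMeasurable f μ) (hg : AEMeasurable g μ) :
    (∫⁻ x, f x * g x ∂μ) ^ 2 ≤ (∫⁻ x, f x ^ 2 ∂μ) * ∫⁻ x, g x ^ 2 ∂μ := by
  have h := ENNReal.lintegral_mul_le_Lp_mul_Lq μ Real.HolderConjugate.two_two hf hg
  have h2 := pow_le_pow_left₀ (zero_le) h 2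
  simp only [Pi.mul_apply] at h2
  refine h2.trans_eq ?_
  rw [mul_pow, ← ENNReal.rpow_natCast, ← ENNReal.rpow_natCast, ← ENNReal.rpow_mul,
    ← ENNReal.rpow_mul]
  norm_num

/-- Cauchy-Schwarz for the dual pair of weights `u` and `u⁻¹`. -/
theorem sq_setLIntegral_area_le {u : ℂ → ℝ} (hu : AEStronglyMeasurable u area)
    (hu_pos : ∀ᵐ z ∂area, 0 < u z) {g : ℂ → ℝ≥0∞} {F : Set ℂ} (hF : MeasurableSet F)
    (hg : AEMeasurable g (area.restrict F)) :
    (∫⁻ z in F, g z ∂area) ^ 2 ≤ (∫⁻ z in F, g z ^ 2 ∂weightedArea u) * dualArea u F := by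
  have hw : AEMeasurable (fun z => ENNReal.ofReal (u z)) (area.restrict F) :=
    hu.aemeasurable.ennreal_ofReal.restrict
  have hpos := ae_restrict_of_ae (s := F) hu_pos
  set w : ℂ → ℝ≥0∞ := fun z => ENNReal.ofReal (u z) with hwdef
  have h1 : ∫⁻ z in F, g z ∂area =
      ∫⁻ z in F, (g z * w z ^ (1 / 2 : ℝ)) * (w z ^ (1 / 2 : ℝ))⁻¹ ∂area := by
    refine lintegral_congr_ae ?_
    filter_upwards [hpos] with z hz
    have h0 : w z ^ (1 / 2 : ℝ) ≠ 0 := by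
      have : w z ≠ 0 := by simpa [hwdef] using hz
      simp [ENNReal.rpow_eq_zero_iff, this]
    have h2 : w z ^ (1 / 2 : ℝ) ≠ ∞ :=
      ENNReal.rpow_ne_top_of_nonneg (by norm_num) (by simp [hwdef])
    rw [mul_assoc, ENNReal.mul_inv_cancel h0 h2, mul_one]
  have hsq : ∀ z, (w z ^ (1 / 2 : ℝ)) ^ 2 = w z := fun z => by
    rw [← ENNReal.rpow_natCast, ← ENNReal.rpow_mul]; norm_num
  rw [h1]
  refine (sq_lintegral_mul_le _ (hg.mul (hw.pow_const _)) (hw.pow_const _).inv).trans_eq ?_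
  congr 1
  · rw [weightedArea, restrict_withDensity hF, lintegral_withDensity_eq_lintegral_mul₀ hw
      (hg.pow_const 2)]
    refine lintegral_congr fun z => ?_
    simp only [Pi.mul_apply]
    rw [mul_pow, hsq, mul_comm]
  · rw [dualArea, withDensity_apply _ hF]
    refine lintegral_congr fun z => ?_
    rw [Pi.inv_apply, ← ENNReal.inv_pow, hsq]

theorem sq_area_le {u : ℂ → ℝ} (hu : AEStronglyMeasurable u area)
    (hu_pos : ∀ᵐ z ∂area, 0 < u z) {F : Set ℂ} (hF : MeasurableSet F) :
    area F ^ 2 ≤ weightedArea u F * dualArea u F := by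
  simpa using sq_setLIntegral_area_le hu hu_pos hF (g := fun _ => 1) aemeasurable_const

/-! ### The B₂ condition on discs centred on the circle. -/

/-- A disc centred on the unit circle lies, inside `𝔻`, in a Carleson square of the same size. -/
theorem exists_ball_inter_subset_carlesonSquare {ζ : ℂ} (hζ : ‖ζ‖ = 1) {ρ : ℝ} (hρ : 0 < ρ)
    (hρ1 : ρ ≤ 1) : ∃ θ : ℝ, Metric.ball ζ ρ ∩ disc ⊆ carlesonSquare θ (2 * Real.pi * ρ) ∧
      carlesonSquare θ (2 * Real.pi * ρ) ⊆ Metric.closedBall ζ ((1 + Real.pi) * ρ) := by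
  have hζe : Complex.exp (ζ.arg * Complex.I) = ζ := by
    have := Complex.norm_mul_exp_arg_mul_I ζ
    rwa [hζ, Complex.ofReal_one, one_mul] at this
  have hζ0 : ζ ≠ 0 := by rw [← norm_pos_iff, hζ]; norm_num
  have hdiv : 2 * Real.pi * ρ / (2 * Real.pi) = ρ := by field_simp
  -- The arc is centred at ζ with half-length πρ, which makes the square's depth exactly ρ.
  refine ⟨ζ.arg - Real.pi * ρ, ?_, ?_⟩
  · rintro z ⟨hz, hzd⟩
    rw [mem_ball_iff_norm] at hz
    have hz1 : ‖z‖ < 1 := by simpa [disc] using hzd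
    have hrad : 1 - ρ < ‖z‖ := by
      have := norm_sub_norm_le ζ z
      rw [hζ, norm_sub_rev] at this
      linarith
    have hz0 : z ≠ 0 := by rw [← norm_pos_iff]; linarith
    set w : ℂ := z / ζ with hw
    have hwn : ‖w‖ = ‖z‖ := by rw [hw, norm_div, hζ, div_one]
    have hw1 : ‖w - 1‖ < ρ := by
      have : w - 1 = (z - ζ) / ζ := by rw [hw]; field_simp
      rwa [this, norm_div, hζ, div_one]
    have hwe := Complex.norm_mul_exp_arg_mul_I w
    set e : ℂ := Complex.exp (w.arg * Complex.I) with he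
    have hen : ‖e‖ = 1 := Complex.norm_exp_ofReal_mul_I _
    have he1 : ‖1 - e‖ ≤ 2 * ρ := by
      have h1 : ‖w - e‖ ≤ ρ := by
        have : w - e = ((‖w‖ : ℂ) - 1) * e := by rw [sub_mul, hwe, one_mul]
        rw [this, norm_mul, hen, mul_one, ← Complex.ofReal_one, ← Complex.ofReal_sub,
          Complex.norm_real, Real.norm_eq_abs, abs_le]
        constructor <;> linarith
      calc ‖1 - e‖ = ‖-(w - 1) + (w - e)‖ := by congr 1; ring
        _ ≤ ‖-(w - 1)‖ + ‖w - e‖ := norm_add_le _ _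
        _ ≤ 2 * ρ := by rw [norm_neg]; linarith
    have harg : |w.arg| ≤ Real.pi * ρ := by
      -- An angle is at most π/2 times its chord; a chord of at most 2ρ fits the half-length πρ.
      have h1 := Complex.angle_le_mul_norm_sub (x := 1) (y := e) (by simp) hen
      have h2 : InnerProductGeometry.angle 1 e = |w.arg| := by
        rw [Complex.angle_one_left (Complex.exp_ne_zero _), Complex.arg_exp_mul_I]
        congr 1
        rw [toIocMod_eq_self]
        have := Complex.arg_mem_Ioc w
        exact ⟨this.1, by linarith [this.2]⟩
      rw [h2] at h1
      nlinarith [Real.pi_pos]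
    rw [abs_le] at harg
    refine ⟨‖z‖, ζ.arg + w.arg, ⟨by linarith, by linarith⟩, by rw [hdiv]; exact hrad.le, hz1, ?_⟩
    rw [Complex.ofReal_add, add_mul, Complex.exp_add, hζe, ← he, ← hwn, mul_left_comm, hwe, hw]
    field_simp
  · rintro z ⟨r, t, ht, hr, hr1, rfl⟩
    rw [hdiv] at hr
    rw [Metric.mem_closedBall, Complex.dist_eq]
    set e := Complex.exp (t * Complex.I) with he
    have hen : ‖e‖ = 1 := Complex.norm_exp_ofReal_mul_I _
    have h1 : ‖(r : ℂ) * e - e‖ ≤ ρ := by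
      have : (r : ℂ) * e - e = ((r - 1 : ℝ) : ℂ) * e := by push_cast; ring
      rw [this, norm_mul, hen, mul_one, Complex.norm_real, Real.norm_eq_abs, abs_le]
      constructor <;> linarith
    have h2 : ‖e - ζ‖ ≤ Real.pi * ρ := by
      have : e - ζ = ζ * (Complex.exp (Complex.I * ((t - ζ.arg : ℝ) : ℂ)) - 1) := by
        conv_lhs => rw [← hζe, he]
        conv_rhs => rw [← hζe]
        rw [mul_sub, ← Complex.exp_add, mul_one, hζe]
        push_cast
        ring_nf
      rw [this, norm_mul, hζ, one_mul]
      refine (Real.norm_exp_I_mul_ofReal_sub_one_le).trans ?_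
      rw [Real.norm_eq_abs, abs_le]
      constructor <;> linarith [ht.1, ht.2]
    calc ‖(r : ℂ) * e - ζ‖ = ‖((r : ℂ) * e - e) + (e - ζ)‖ := by congr 1; ring
      _ ≤ _ := norm_add_le _ _
      _ ≤ _ := by linarith

/-- The `B₂` condition, on the discs centred on the unit circle. -/
theorem BekolleBonami.ball {u : ℂ → ℝ} (h : BekolleBonami u) :
    ∃ K : ℝ≥0, ∀ ζ : ℂ, ‖ζ‖ = 1 → ∀ ρ : ℝ, 0 < ρ →
      weightedArea u (Metric.ball ζ ρ) * dualArea u (Metric.ball ζ ρ) ≤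
        K * ENNReal.ofReal ρ ^ 4 := by
  obtain ⟨C, hC⟩ := h
  have small : ∀ ζ : ℂ, ‖ζ‖ = 1 → ∀ s : Set ℂ, MeasurableSet s → ∀ ρ : ℝ, 0 < ρ → ρ ≤ 1 →
      (∃ θ, s ∩ disc ⊆ carlesonSquare θ (2 * Real.pi * ρ) ∧ carlesonSquare θ (2 * Real.pi * ρ) ⊆
        Metric.closedBall ζ ((1 + Real.pi) * ρ)) →
      weightedArea u s * dualArea u s ≤
        (C * (1 + NNReal.pi) ^ 4 : ℝ≥0) * ENNReal.ofReal ρ ^ 4 := by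
    rintro ζ hζ s hs ρ hρ hρ1 ⟨θ, h1, h2⟩
    have hsd : MeasurableSet (s ∩ disc) := hs.inter Metric.isOpen_ball.measurableSet
    have hB := hC θ (2 * Real.pi * ρ) (by positivity)
      (by nlinarith [Real.pi_pos])
    -- With the denominator cleared, only an upper bound for the area of the square is needed.
    rw [ENNReal.div_le_iff_le_mul (Or.inr ENNReal.coe_ne_top)] at hB
    · have e1 : weightedArea u s ≤
          ∫⁻ z in carlesonSquare θ (2 * Real.pi * ρ), ENNReal.ofReal (u z) ∂area := by
        refine (measure_le_of_inter_disc_subset (weightedArea_compl_disc u) subset_rfl).trans ?_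
        rw [weightedArea, withDensity_apply _ hsd]
        exact lintegral_mono_set h1
      have e2 : dualArea u s ≤
          ∫⁻ z in carlesonSquare θ (2 * Real.pi * ρ), (ENNReal.ofReal (u z))⁻¹ ∂area := by
        refine (measure_le_of_inter_disc_subset (dualArea_compl_disc u) subset_rfl).trans ?_
        rw [dualArea, withDensity_apply _ hsd]
        exact lintegral_mono_set h1
      have e3 : area (carlesonSquare θ (2 * Real.pi * ρ)) ≤
          (1 + NNReal.pi : ℝ≥0) ^ 2 * ENNReal.ofReal ρ ^ 2 := by
        refine ((measure_mono h2).trans (area_closedBall_le _ _)).trans_eq ?_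
        rw [ENNReal.ofReal_mul (by positivity), mul_pow]
        congr 2
        rw [ENNReal.ofReal, Real.toNNReal_add zero_le_one Real.pi_pos.le,
          ← NNReal.coe_real_pi, Real.toNNReal_coe, Real.toNNReal_one]
      calc _ ≤ _ := mul_le_mul' e1 e2
        _ ≤ _ := hB
        _ ≤ C * ((1 + NNReal.pi : ℝ≥0) ^ 2 * ENNReal.ofReal ρ ^ 2) ^ 2 := by gcongr
        _ = _ := by push_cast; ring
    · exact Or.inl (ENNReal.pow_ne_top (((measure_mono h2).trans_lt
        ((area_closedBall_le _ _).trans_lt (by finiteness))).ne))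
  refine ⟨C * (1 + NNReal.pi) ^ 4, fun ζ hζ ρ hρ => ?_⟩
  rcases lt_or_ge ρ 1 with hρ1 | hρ1
  · exact small ζ hζ _ measurableSet_ball ρ hρ hρ1.le
      (exists_ball_inter_subset_carlesonSquare hζ hρ hρ1.le)
  -- For ρ ≥ 1 the square of the full circle is all of 𝔻, and the bound at radius 1 suffices because
  -- ρ⁴ ≥ 1.
  · have hfull : ∃ θ, Metric.ball ζ ρ ∩ disc ⊆ carlesonSquare θ (2 * Real.pi * 1) ∧
        carlesonSquare θ (2 * Real.pi * 1) ⊆ Metric.closedBall ζ ((1 + Real.pi) * 1) := by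
      refine ⟨-Real.pi, ?_, ?_⟩
      · rintro z ⟨-, hz⟩
        have hz1 : ‖z‖ < 1 := by simpa [disc] using hz
        refine ⟨‖z‖, z.arg, ?_, ?_, hz1, (Complex.norm_mul_exp_arg_mul_I z).symm⟩
        · have := Complex.arg_mem_Ioc z
          exact ⟨this.1.le, by linarith [this.2]⟩
        · rw [mul_one, div_self (by positivity)]; simp
      · rintro z ⟨r, t, -, hr, hr1, rfl⟩
        rw [mul_one, div_self (by positivity)] at hr
        rw [Metric.mem_closedBall, Complex.dist_eq]
        refine (norm_sub_le _ _).trans ?_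
        rw [norm_mul, Complex.norm_exp_ofReal_mul_I, hζ, Complex.norm_real, Real.norm_eq_abs,
          abs_of_nonneg (by linarith)]
        linarith [Real.pi_gt_three]
    refine (small ζ hζ _ measurableSet_ball 1 one_pos le_rfl hfull).trans ?_
    gcongr

theorem disc_subset_ball {ζ : ℂ} (hζ : ‖ζ‖ = 1) {ρ : ℝ} (hρ : 2 ≤ ρ) :
    disc ⊆ Metric.ball ζ ρ := by
  intro z hz
  have hz1 : ‖z‖ < 1 := by simpa [disc] using hz
  rw [mem_ball_iff_norm]
  have := norm_sub_le z ζ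
  linarith

theorem isFiniteMeasure_weightedArea {u : ℂ → ℝ} (hu : Integrable u area) :
    IsFiniteMeasure (weightedArea u) :=
  isFiniteMeasure_withDensity hu.lintegral_lt_top.ne

theorem area_ball_ne_zero {c : ℂ} {r : ℝ} (h : Metric.ball c r ⊆ disc) (hr : 0 < r) :
    area (Metric.ball c r) ≠ 0 := by
  rw [area_ball h]
  simpa using hr

/-- Integrability of u⁻¹ follows from B₂ on the whole disc: the μ-mass is positive, so an infinite
dual mass would make the bounded product infinite. -/
theorem isFiniteMeasure_dualArea {u : ℂ → ℝ} (hu : AEStronglyMeasurable u area)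
    (hu_pos : ∀ᵐ z ∂area, 0 < u z) (h : BekolleBonami u) : IsFiniteMeasure (dualArea u) := by
  obtain ⟨K, hK⟩ := h.ball
  have h1 := hK 1 (by simp) 2 two_pos
  have hd : dualArea u Set.univ ≤ dualArea u (Metric.ball 1 2) :=
    measure_le_of_inter_disc_subset (dualArea_compl_disc u)
      (Set.inter_subset_right.trans (disc_subset_ball (by simp) le_rfl))
  have hm : weightedArea u (Metric.ball 1 2) ≠ 0 := by
    intro h0
    have h2 := sq_area_le hu hu_pos (F := Metric.ball (1 : ℂ) 2) measurableSet_ball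
    rw [h0, zero_mul, nonpos_iff_eq_zero] at h2
    have h3 := measure_mono_null (disc_subset_ball (ζ := 1) (by simp) le_rfl)
      (pow_eq_zero_iff two_ne_zero |>.1 h2)
    exact area_ball_ne_zero (c := 0) (r := 1) subset_rfl one_pos h3
  refine ⟨hd.trans_lt (lt_of_not_ge fun htop => ?_)⟩
  rw [top_le_iff.1 htop, ENNReal.mul_top hm] at h1
  exact absurd h1 (not_le.2 (by finiteness))

/-! ### Geometric growth of the dual masses. -/

/-- A chain of masses `m k`, `s k` with `m k * s k` of order at most `16 ^ k`, where `s` grows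
geometrically until `m` becomes stationary: then `m k` is of order at most `(16 q) ^ k`. -/
theorem chain_le {m s : ℕ → ℝ} {P : ℕ → Prop} {q L : ℝ} (hq : 1 / 16 ≤ q) (hq1 : q ≤ 1)
    (hL : 0 ≤ L) (hs : ∀ k, 0 < s k) (hs_mono : Monotone s)
    (hms : ∀ k, m k * s k ≤ L * 16 ^ k) (hP : ∀ k, P (k + 1) → P k)
    (hgrow : ∀ k, P (k + 1) → s k ≤ q * s (k + 1)) (hstat : ∀ k, ¬P k → m (k + 1) ≤ m k) (k : ℕ) :
    m k ≤ q⁻¹ * L / s 0 * (16 * q) ^ k := by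
  have hq0 : 0 < q := by linarith
  have growth : ∀ k, P k → s 0 ≤ q ^ k * s k := by
    intro k
    induction k with
    | zero => simp
    | succ k ih =>
      intro hk
      calc s 0 ≤ q ^ k * s k := ih (hP k hk)
        _ ≤ q ^ k * (q * s (k + 1)) := by gcongr; exact hgrow k hk
        _ = _ := by ring
  have key : ∀ k, q * s 0 ≤ q ^ k * s k → m k ≤ q⁻¹ * L / s 0 * (16 * q) ^ k := by
    intro k hk
    calc m k ≤ L * 16 ^ k / s k := (le_div_iff₀ (hs k)).2 (hms k)
      _ = L * 16 ^ k * q ^ k / (q ^ k * s k) := by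
        have := hs k
        field_simp
      _ ≤ L * 16 ^ k * q ^ k / (q * s 0) := by
        have := hs 0
        gcongr
      _ = _ := by
        have := hs 0
        rw [mul_pow]
        field_simp
  induction k with
  | zero =>
    refine key 0 ?_
    nlinarith [hs 0]
  | succ k ih =>
    by_cases hk : P k
    -- Growth is known only up to index k. Monotonicity of `s` covers the next index at the cost of
    -- one factor q, the slack allowed in `key`.
    · refine key _ ?_
      calc q * s 0 ≤ q * (q ^ k * s k) := by gcongr; exact growth k hk
        _ ≤ q * (q ^ k * s (k + 1)) := by gcongr; exact hs_mono k.le_succ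
        _ = _ := by ring
    · have h0 := hs 0
      calc m (k + 1) ≤ m k := hstat k hk
        _ ≤ _ := ih
        -- Once `m` is stationary, the bound persists because 16 q ≥ 1.
        _ ≤ _ := by
          gcongr
          · linarith
          · exact k.le_succ

theorem exists_ball_subset_annulus {ζ : ℂ} (hζ : ‖ζ‖ = 1) {R : ℝ} (hR : 0 < R) (hR2 : R ≤ 2) :
    ∃ c : ℂ, Metric.ball c (R / 4) ⊆ disc ∧ Metric.ball c (R / 4) ⊆ Metric.ball ζ R ∧
      Disjoint (Metric.ball c (R / 4)) (Metric.ball ζ (R / 2)) := by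
  have hc : ‖((1 - 3 * R / 4 : ℝ) : ℂ) * ζ - ζ‖ = 3 * R / 4 := by
    have : ((1 - 3 * R / 4 : ℝ) : ℂ) * ζ - ζ = ((-(3 * R / 4) : ℝ) : ℂ) * ζ := by
      push_cast; ring
    rw [this, norm_mul, hζ, mul_one, Complex.norm_real, norm_neg,
      Real.norm_of_nonneg (by positivity)]
  -- The centre is halfway across the annulus R/2 < |z - ζ| < R, on the inward radius; R ≤ 2 keeps
  -- the small disc in 𝔻.
  refine ⟨((1 - 3 * R / 4 : ℝ) : ℂ) * ζ, ?_, ?_, ?_⟩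
  · refine Metric.ball_subset_ball' ?_
    rw [dist_zero_right, norm_mul, hζ, mul_one, Complex.norm_real, Real.norm_eq_abs]
    have : |1 - 3 * R / 4| ≤ 1 - R / 4 := abs_le.2 ⟨by linarith, by linarith⟩
    linarith
  · refine Metric.ball_subset_ball' ?_
    rw [dist_eq_norm, hc]
    linarith
  · refine Metric.ball_disjoint_ball ?_
    rw [dist_eq_norm, hc]
    linarith

/-- The masses `u⁻¹ dA` of concentric discs centred on the unit circle grow geometrically. -/
theorem dualArea_ball_half_le {u : ℂ → ℝ} [IsFiniteMeasure (weightedArea u)]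
    [IsFiniteMeasure (dualArea u)] (hu : AEStronglyMeasurable u area)
    (hu_pos : ∀ᵐ z ∂area, 0 < u z) {K : ℝ} (hK0 : 0 < K) {ζ : ℂ} (hζ : ‖ζ‖ = 1) {R : ℝ}
    (hR : 0 < R) (hR2 : R ≤ 2)
    (hK : (weightedArea u).real (Metric.ball ζ R) * (dualArea u).real (Metric.ball ζ R) ≤
      K * R ^ 4) :
    (dualArea u).real (Metric.ball ζ (R / 2)) ≤
      (1 - 1 / (256 * K)) * (dualArea u).real (Metric.ball ζ R) := by
  obtain ⟨c, hcd, hcR, hdisj⟩ := exists_ball_subset_annulus hζ hR hR2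
  have hF := sq_area_le hu hu_pos (F := Metric.ball c (R / 4)) measurableSet_ball
  have hF' : (R / 4) ^ 4 ≤ (weightedArea u).real (Metric.ball c (R / 4)) *
      (dualArea u).real (Metric.ball c (R / 4)) := by
    have := ENNReal.toReal_mono (by finiteness) hF
    rw [area_ball hcd, ENNReal.toReal_mul, ← pow_mul, ENNReal.toReal_pow,
      ENNReal.toReal_ofReal (by positivity)] at this
    exact this
  have hm : (weightedArea u).real (Metric.ball c (R / 4)) ≤
      (weightedArea u).real (Metric.ball ζ R) := measureReal_mono hcR
  have hadd : (dualArea u).real (Metric.ball c (R / 4)) +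
      (dualArea u).real (Metric.ball ζ (R / 2)) ≤ (dualArea u).real (Metric.ball ζ R) := by
    rw [← measureReal_union hdisj measurableSet_ball]
    exact measureReal_mono (Set.union_subset hcR (Metric.ball_subset_ball (by linarith)))
  set m := (weightedArea u).real (Metric.ball ζ R)
  set s := (dualArea u).real (Metric.ball ζ R)
  set f := (dualArea u).real (Metric.ball c (R / 4))
  have hf0 : 0 ≤ f := measureReal_nonneg
  have hs0 : 0 ≤ s := measureReal_nonneg
  have h1 : (R / 4) ^ 4 ≤ m * f := hF'.trans (by gcongr)
  have hm0 : 0 < m := by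
    by_contra hcon
    have : m = 0 := le_antisymm (not_lt.1 hcon) measureReal_nonneg
    rw [this, zero_mul] at h1
    exact absurd h1 (not_le.2 (by positivity))
  -- B₂ gives m s ≤ K R⁴, while Cauchy-Schwarz on the small disc gives R⁴ ≤ 256 m f, with 256 = 4⁴.
  have h2 : m * s ≤ m * (256 * K * f) := by nlinarith
  have h3 : s ≤ 256 * K * f := le_of_mul_le_mul_left h2 hm0
  have h4 : 1 / (256 * K) * s ≤ f := by
    rw [one_div, inv_mul_le_iff₀ (by positivity)]
    exact h3
  linarith

/-! ### Dyadic estimate of the norm of the Bergman kernel. -/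

theorem exists_norm_eq_one_norm_sub_eq (a : ℂ) (ha : ‖a‖ ≤ 1) :
    ∃ ζ : ℂ, ‖ζ‖ = 1 ∧ ‖a - ζ‖ = 1 - ‖a‖ := by
  refine ⟨Complex.exp (a.arg * Complex.I), Complex.norm_exp_ofReal_mul_I _, ?_⟩
  set e := Complex.exp (a.arg * Complex.I) with he
  have hen : ‖e‖ = 1 := Complex.norm_exp_ofReal_mul_I _
  have : a - e = ((‖a‖ - 1 : ℝ) : ℂ) * e := by
    push_cast
    rw [sub_mul, one_mul, he, Complex.norm_mul_exp_arg_mul_I]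
  rw [this, norm_mul, hen, mul_one, Complex.norm_real, Real.norm_eq_abs, abs_of_nonpos (by linarith)]
  ring

/-- |1 - āz|² - |z - a|² = (1 - |a|²)(1 - |z|²). -/
theorem norm_sub_le_norm_one_sub {a z : ℂ} (ha : ‖a‖ ≤ 1) (hz : ‖z‖ ≤ 1) :
    ‖z - a‖ ≤ ‖1 - conj a * z‖ := by
  refine le_of_sq_le_sq ?_ (norm_nonneg _)
  have ha' : ‖a‖ ^ 2 ≤ 1 := pow_le_one₀ (norm_nonneg _) ha
  have hz' : ‖z‖ ^ 2 ≤ 1 := pow_le_one₀ (norm_nonneg _) hz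
  rw [← Complex.normSq_eq_norm_sq, Complex.normSq_apply] at ha' hz' ⊢
  rw [← Complex.normSq_eq_norm_sq, Complex.normSq_apply]
  simp only [Complex.sub_re, Complex.sub_im, Complex.one_re, Complex.one_im, Complex.mul_re,
    Complex.mul_im, Complex.conj_re, Complex.conj_im]
  nlinarith [mul_nonneg (sub_nonneg.2 ha') (sub_nonneg.2 hz')]

theorem one_sub_norm_le_norm_one_sub {a z : ℂ} (hz : ‖z‖ ≤ 1) :
    1 - ‖a‖ ≤ ‖1 - conj a * z‖ := by
  have h := norm_sub_norm_le (1 : ℂ) (conj a * z)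
  rw [norm_one, norm_mul, Complex.norm_conj] at h
  have : ‖a‖ * ‖z‖ ≤ ‖a‖ := mul_le_of_le_one_right (norm_nonneg _) hz
  linarith

theorem enorm_bergmanKernel_sq (a z : ℂ) :
    ‖bergmanKernel a z‖ₑ ^ 2 = ENNReal.ofReal ((‖1 - conj a * z‖ ^ 4)⁻¹) := by
  rw [bergmanKernel, ← ofReal_norm, ← ENNReal.ofReal_pow (norm_nonneg _)]
  congr 1
  rw [norm_div, norm_one, norm_pow, one_div, inv_pow, ← pow_mul]

/-- One term suffices: the least k whose disc contains z. Missing the previous disc forces |1 - āz|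
≥ 2^(k-1)(1 - |a|); for k = 0, |1 - āz| ≥ 1 - |a| is enough. -/
theorem enorm_bergmanKernel_sq_le_tsum {a ζ : ℂ} (ha : ‖a‖ < 1)
    (hζa : ‖a - ζ‖ = 1 - ‖a‖) {z : ℂ} (hz : ‖z‖ < 1) :
    ‖bergmanKernel a z‖ₑ ^ 2 ≤ ∑' k : ℕ, ENNReal.ofReal (16 * ((2 ^ k * (1 - ‖a‖)) ^ 4)⁻¹) *
      (Metric.ball ζ (2 ^ k * (4 * (1 - ‖a‖)))).indicator 1 z := by
  have hh : 0 < 1 - ‖a‖ := by linarith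
  set h := 1 - ‖a‖ with hdef
  have hlow : h ≤ ‖1 - conj a * z‖ := one_sub_norm_le_norm_one_sub hz.le
  have hex : ∃ k : ℕ, ‖z - ζ‖ < 2 ^ k * (4 * h) := by
    obtain ⟨k, hk⟩ := pow_unbounded_of_one_lt (‖z - ζ‖ / (4 * h)) (one_lt_two)
    exact ⟨k, (div_lt_iff₀ (by positivity)).1 hk⟩
  classical
  have hk := Nat.find_spec hex
  have hmin := fun j => Nat.find_min hex (m := j)
  set k := Nat.find hex
  have hmain : 2 ^ k * h ≤ 2 * ‖1 - conj a * z‖ := by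
    rcases Nat.eq_zero_or_pos k with h0 | hpos
    · rw [h0]; linarith
    · obtain ⟨j, hj⟩ : ∃ j, k = j + 1 := ⟨k - 1, by omega⟩
      have h1 := not_lt.1 (hmin j (by omega))
      have h2 := norm_sub_le_norm_one_sub ha.le hz.le
      have h3 : ‖z - ζ‖ ≤ ‖z - a‖ + ‖a - ζ‖ := norm_sub_le_norm_sub_add_norm_sub _ _ _
      have h4 : (1 : ℝ) ≤ 2 ^ j := one_le_pow₀ one_le_two
      rw [hj, pow_succ]
      nlinarith
  refine le_trans ?_ (ENNReal.le_tsum k)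
  rw [Set.indicator_of_mem (mem_ball_iff_norm.2 hk), Pi.one_apply, mul_one,
    enorm_bergmanKernel_sq]
  refine ENNReal.ofReal_le_ofReal ?_
  have h5 : (2 ^ k * h) ^ 4 ≤ (2 * ‖1 - conj a * z‖) ^ 4 := by gcongr
  have h6 : 0 < ‖1 - conj a * z‖ := hh.trans_le hlow
  rw [← div_eq_mul_inv, le_div_iff₀ (by positivity), inv_mul_le_iff₀ (by positivity)]
  linarith [mul_pow 2 ‖1 - conj a * z‖ 4]

/-- For a `B₂` weight, the norm of a Bergman kernel is dual to the mass `u⁻¹ dA` of a disc. -/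
theorem exists_normSq_bergmanKernel_mul_dualArea_le {u : ℂ → ℝ} (hu_int : Integrable u area)
    (hu_pos : ∀ᵐ z ∂area, 0 < u z) (h : BekolleBonami u) :
    ∃ C : ℝ≥0, ∀ a ∈ disc, normSq u (bergmanKernel a) *
      dualArea u (Metric.ball a (2 * (1 - ‖a‖))) ≤ C := by
  have hu := hu_int.aestronglyMeasurable
  have := isFiniteMeasure_weightedArea hu_int
  have := isFiniteMeasure_dualArea hu hu_pos h
  obtain ⟨K₀, hK₀⟩ := h.ball
  -- Enlarging the constant makes K ≥ 1, hence 1/2 ≤ q < 1.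
  set K : ℝ := K₀ + 1 with hKdef
  have hK1 : 1 ≤ K := by rw [hKdef]; linarith [K₀.coe_nonneg]
  have hK : ∀ ζ : ℂ, ‖ζ‖ = 1 → ∀ ρ : ℝ, 0 < ρ →
      (weightedArea u).real (Metric.ball ζ ρ) * (dualArea u).real (Metric.ball ζ ρ) ≤
        K * ρ ^ 4 := by
    intro ζ hζ ρ hρ
    have := ENNReal.toReal_mono (by finiteness) (hK₀ ζ hζ ρ hρ)
    rw [ENNReal.toReal_mul, ENNReal.toReal_mul, ENNReal.toReal_pow, ENNReal.coe_toReal,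
      ENNReal.toReal_ofReal hρ.le] at this
    refine this.trans ?_
    gcongr
    linarith
  set q : ℝ := 1 - 1 / (256 * K) with hq
  have hinv : 1 / (256 * K) ≤ 1 / 2 := one_div_le_one_div_of_le two_pos (by linarith)
  have hinv0 : 0 < 1 / (256 * K) := by positivity
  have hq0 : 1 / 16 ≤ q := by linarith
  have hq1 : q < 1 := by linarith
  have hqpos : 0 < q := by linarith
  set c : ℝ := 16 * q⁻¹ * (K * 256) with hc
  have hc0 : 0 ≤ c := by positivity
  refine ⟨Real.toNNReal (c * (1 - q)⁻¹), fun a ha => ?_⟩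
  have ha1 : ‖a‖ < 1 := by simpa [disc] using ha
  obtain ⟨ζ, hζ, hζa⟩ := exists_norm_eq_one_norm_sub_eq a ha1.le
  have hh : 0 < 1 - ‖a‖ := by linarith
  set r := 4 * (1 - ‖a‖) with hr
  have hr0 : 0 < r := by positivity
  have hsub : Metric.ball a (2 * (1 - ‖a‖)) ⊆ Metric.ball ζ r := by
    refine Metric.ball_subset_ball' ?_
    rw [dist_eq_norm, hζa]
    linarith
  have hspos : ∀ k : ℕ, 0 < (dualArea u).real (Metric.ball ζ (2 ^ k * r)) := by
    intro k
    have had : Metric.ball a (1 - ‖a‖) ⊆ disc := by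
      refine Metric.ball_subset_ball' ?_
      simp
    have h1 := sq_area_le hu hu_pos (F := Metric.ball a (1 - ‖a‖)) measurableSet_ball
    have h2 : dualArea u (Metric.ball a (1 - ‖a‖)) ≠ 0 := by
      intro h0
      rw [h0, mul_zero, nonpos_iff_eq_zero, pow_eq_zero_iff two_ne_zero] at h1
      exact area_ball_ne_zero had hh h1
    refine ENNReal.toReal_pos (fun h0 => h2 (measure_mono_null ?_ h0)) (by finiteness)
    refine (Metric.ball_subset_ball (by linarith)).trans (hsub.trans
      (Metric.ball_subset_ball ?_))
    exact le_mul_of_one_le_left hr0.le (one_le_pow₀ one_le_two)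
  have hchain := chain_le (m := fun k => (weightedArea u).real (Metric.ball ζ (2 ^ k * r)))
    (s := fun k => (dualArea u).real (Metric.ball ζ (2 ^ k * r))) (P := fun k => 2 ^ k * r ≤ 2)
    (L := K * r ^ 4) hq0 hq1.le (by positivity) hspos
    (fun i j hij => measureReal_mono (Metric.ball_subset_ball (by gcongr; exact one_le_two)))
    (fun k => by
      refine (hK ζ hζ _ (by positivity)).trans_eq ?_
      rw [mul_pow, ← pow_mul, mul_comm k, pow_mul]
      norm_num
      ring)
    (fun k hk => by
      refine le_trans ?_ hk
      gcongr
      · exact one_le_two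
      · exact k.le_succ)
    (fun k hk => by
      have := dualArea_ball_half_le hu hu_pos (by linarith) hζ (by positivity) hk
        (hK ζ hζ _ (by positivity))
      rwa [show 2 ^ (k + 1) * r / 2 = 2 ^ k * r by ring] at this)
    (fun k hk => by
      refine ENNReal.toReal_mono (by finiteness) (measure_le_of_inter_disc_subset
        (weightedArea_compl_disc u) (Set.inter_subset_right.trans
          (disc_subset_ball hζ (not_le.1 hk).le))))
  set s₀ := (dualArea u).real (Metric.ball ζ (2 ^ 0 * r)) with hs₀
  have hs₀pos : 0 < s₀ := hspos 0
  have hdisc : ∀ᵐ z ∂weightedArea u, z ∈ disc := by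
    rw [ae_iff]; exact weightedArea_compl_disc u
  have hnorm : normSq u (bergmanKernel a) ≤ ENNReal.ofReal (c / s₀ * (1 - q)⁻¹) := by
    calc normSq u (bergmanKernel a)
        ≤ ∫⁻ z, ∑' k : ℕ, ENNReal.ofReal (16 * ((2 ^ k * (1 - ‖a‖)) ^ 4)⁻¹) *
            (Metric.ball ζ (2 ^ k * r)).indicator 1 z ∂weightedArea u := by
          refine lintegral_mono_ae ?_
          filter_upwards [hdisc] with z hz
          exact enorm_bergmanKernel_sq_le_tsum ha1 hζa (by simpa [disc] using hz)
      _ = ∑' k : ℕ, ENNReal.ofReal (16 * ((2 ^ k * (1 - ‖a‖)) ^ 4)⁻¹) *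
            weightedArea u (Metric.ball ζ (2 ^ k * r)) := by
          rw [lintegral_tsum]
          · refine tsum_congr fun k => ?_
            rw [lintegral_const_mul _ (measurable_one.indicator measurableSet_ball),
              lintegral_indicator_one measurableSet_ball]
          · intro k
            exact ((measurable_one.indicator measurableSet_ball).const_mul _).aemeasurable
      _ ≤ ∑' k : ℕ, ENNReal.ofReal (c / s₀ * q ^ k) := by
          refine ENNReal.tsum_le_tsum fun k => ?_
          rw [← ENNReal.ofReal_toReal (measure_ne_top (weightedArea u)
            (Metric.ball ζ (2 ^ k * r))), ← ENNReal.ofReal_mul (by positivity)]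
          refine ENNReal.ofReal_le_ofReal ?_
          calc _ ≤ 16 * ((2 ^ k * (1 - ‖a‖)) ^ 4)⁻¹ *
                (q⁻¹ * (K * r ^ 4) / s₀ * (16 * q) ^ k) := by
                gcongr
                exact hchain k
            -- The factor 16^k cancels (2^k)⁴, leaving the convergent series of q^k; r = 4(1 - |a|)
            -- contributes the 256 in c.
            _ = _ := by
                rw [hc, hr, mul_pow, mul_pow, mul_pow, ← pow_mul, mul_comm k, pow_mul]
                norm_num
                field_simp
      _ = _ := by
          rw [← ENNReal.ofReal_tsum_of_nonneg (fun k => by positivity)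
            ((summable_geometric_of_lt_one hqpos.le hq1).mul_left _), tsum_mul_left,
            tsum_geometric_of_lt_one hqpos.le hq1]
  have h1q : 0 < 1 - q := by linarith
  calc _ ≤ ENNReal.ofReal (c / s₀ * (1 - q)⁻¹) * ENNReal.ofReal s₀ := by
        gcongr
        rw [hs₀, pow_zero, one_mul, Measure.real, ENNReal.ofReal_toReal (by finiteness)]
        exact measure_mono hsub
    _ = ENNReal.ofReal (c * (1 - q)⁻¹) := by
        rw [← ENNReal.ofReal_mul (by positivity)]
        congr 1
        field_simp
    _ = _ := rfl

/-! ### Sub-mean value inequalities. -/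

theorem measurable_indicator_enorm {f : ℂ → ℂ} {s : Set ℂ} (hs : MeasurableSet s)
    (hf : ContinuousOn f s) : Measurable (s.indicator fun z => ‖f z‖ₑ) := by
  classical
  rw [← Set.piecewise_eq_indicator]
  exact ContinuousOn.measurable_piecewise hf.enorm continuousOn_const hs

theorem enorm_mul_two_pi_le_lintegral_circleMap {f : ℂ → ℂ} {a : ℂ} {R r : ℝ}
    (hf : DifferentiableOn ℂ f (Metric.ball a R)) (hr : 0 < r) (hrR : r < R) :
    ‖f a‖ₑ * ENNReal.ofReal (2 * Real.pi) ≤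
      ∫⁻ θ in Set.Ioo (-Real.pi) Real.pi, ‖f (circleMap a r θ)‖ₑ := by
  have hd : DiffContOnCl ℂ f (Metric.ball a |r|) := by
    rw [abs_of_pos hr]
    exact (hf.mono (Metric.closedBall_subset_ball hrR)).diffContOnCl_ball subset_rfl
  have hmean := hd.circleAverage
  rw [Real.circleAverage_def] at hmean
  have hper : Function.Periodic (fun θ => f (circleMap a r θ)) (2 * Real.pi) :=
    fun θ => by simp only [periodic_circleMap a r θ]
  -- The angular interval is shifted to (-π, π) to match the target of polar coordinates.
  have hshift := hper.intervalIntegral_add_eq 0 (-Real.pi)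
  rw [zero_add, show -Real.pi + 2 * Real.pi = Real.pi by ring,
    intervalIntegral.integral_of_le (by linarith [Real.pi_pos] : -Real.pi ≤ Real.pi),
    ← setIntegral_congr_set Ioo_ae_eq_Ioc] at hshift
  have h2 : f a * ((2 * Real.pi : ℝ) : ℂ) =
      ∫ θ in Set.Ioo (-Real.pi) Real.pi, f (circleMap a r θ) := by
    rw [← hshift, ← hmean, Complex.real_smul, Complex.ofReal_inv, mul_comm, ← mul_assoc,
      mul_inv_cancel₀, one_mul]
    exact_mod_cast Real.two_pi_pos.ne'
  have h3 : ‖f a‖ₑ * ENNReal.ofReal (2 * Real.pi) = ‖f a * ((2 * Real.pi : ℝ) : ℂ)‖ₑ := by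
    rw [enorm_mul, ← ofReal_norm ((2 * Real.pi : ℝ) : ℂ), Complex.norm_real,
      Real.norm_of_nonneg Real.two_pi_pos.le]
  rw [h3, h2]
  exact enorm_integral_le_lintegral_enorm _

/-- The sub-mean value property over discs. -/
theorem enorm_mul_le_lintegral_ball {f : ℂ → ℂ} {a : ℂ} {R : ℝ} (hR : 0 < R)
    (hf : DifferentiableOn ℂ f (Metric.ball a R)) :
    ‖f a‖ₑ * ENNReal.ofReal (Real.pi * R ^ 2) ≤ ∫⁻ z in Metric.ball a R, ‖f z‖ₑ := by
  set G : ℂ → ℝ≥0∞ := (Metric.ball a R).indicator fun z => ‖f z‖ₑ with hG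
  have hGm : Measurable G := measurable_indicator_enorm measurableSet_ball hf.continuousOn
  have hpolar : ∀ p : ℝ × ℝ, Complex.polarCoord.symm p + a = circleMap a p.1 p.2 := by
    intro p
    rw [circleMap, Complex.exp_mul_I, Complex.polarCoord_symm_apply, add_comm,
      Complex.ofReal_cos, Complex.ofReal_sin]
  have hcm : Measurable fun p : ℝ × ℝ => circleMap a p.1 p.2 := by
    unfold circleMap
    fun_prop
  have hin : ∫⁻ r in Set.Ioo 0 R, ENNReal.ofReal r = ENNReal.ofReal (R ^ 2 / 2) := by
    rw [← ofReal_integral_eq_lintegral_ofReal, ← setIntegral_congr_set Ioo_ae_eq_Ioc.symm,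
      ← intervalIntegral.integral_of_le hR.le, integral_id]
    · simp
    · exact (continuous_id.integrableOn_Icc (a := 0) (b := R)).mono_set Set.Ioo_subset_Icc_self
    · filter_upwards [ae_restrict_mem measurableSet_Ioo] with r hr using hr.1.le
  calc ‖f a‖ₑ * ENNReal.ofReal (Real.pi * R ^ 2)
      = ∫⁻ r in Set.Ioo 0 R, ENNReal.ofReal r * (‖f a‖ₑ * ENNReal.ofReal (2 * Real.pi)) := by
        rw [lintegral_mul_const _ ENNReal.measurable_ofReal, hin, mul_left_comm,
          ← ENNReal.ofReal_mul (by positivity)]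
        congr 2
        ring
    _ ≤ ∫⁻ r in Set.Ioo 0 R, ENNReal.ofReal r *
          ∫⁻ θ in Set.Ioo (-Real.pi) Real.pi, G (circleMap a r θ) := by
        refine setLIntegral_mono' measurableSet_Ioo fun r hr => ?_
        gcongr
        refine (enorm_mul_two_pi_le_lintegral_circleMap hf hr.1 hr.2).trans_eq ?_
        refine lintegral_congr fun θ => ?_
        rw [hG, Set.indicator_of_mem]
        rw [mem_ball_iff_norm, circleMap_sub_center, norm_circleMap_zero, abs_of_pos hr.1]
        exact hr.2
    _ ≤ ∫⁻ r in Set.Ioi 0, ENNReal.ofReal r *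
          ∫⁻ θ in Set.Ioo (-Real.pi) Real.pi, G (circleMap a r θ) :=
        lintegral_mono_set Set.Ioo_subset_Ioi_self
    _ = ∫⁻ p in Complex.polarCoord.target,
          ENNReal.ofReal p.1 • G (Complex.polarCoord.symm p + a) := by
        simp_rw [hpolar]
        rw [Complex.polarCoord_target, Measure.volume_eq_prod, ← Measure.prod_restrict,
          lintegral_prod]
        · refine lintegral_congr fun r => ?_
          simp only [smul_eq_mul]
          rw [lintegral_const_mul]
          exact hGm.comp (hcm.comp measurable_prodMk_left)
        · exact ((ENNReal.measurable_ofReal.comp measurable_fst).smul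
            (hGm.comp hcm)).aemeasurable
    _ = ∫⁻ z, G (z + a) := Complex.lintegral_comp_polarCoord_symm fun z => G (z + a)
    _ = ∫⁻ z, G z := lintegral_add_right_eq_self G a
    _ = _ := lintegral_indicator measurableSet_ball _

theorem enorm_mul_le_lintegral_area {f : ℂ → ℂ} {a : ℂ} {R : ℝ} (hR : 0 < R)
    (hd : Metric.ball a R ⊆ disc) (hf : DifferentiableOn ℂ f (Metric.ball a R)) :
    ‖f a‖ₑ * ENNReal.ofReal R ^ 2 ≤ ∫⁻ z in Metric.ball a R, ‖f z‖ₑ ∂area := by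
  rw [area, Measure.restrict_smul, Measure.restrict_restrict measurableSet_ball,
    Set.inter_eq_left.2 hd, lintegral_smul_measure, smul_eq_mul]
  refine le_trans (le_of_eq ?_) (mul_le_mul_right (enorm_mul_le_lintegral_ball hR hf) _)
  rw [mul_left_comm, ← ENNReal.ofReal_mul (by positivity), ← ENNReal.ofReal_pow hR.le]
  congr 2
  field_simp

theorem ball_one_sub_norm_subset_disc (a : ℂ) : Metric.ball a (1 - ‖a‖) ⊆ disc := by
  refine Metric.ball_subset_ball' ?_
  simp

/-- Weighted sub-mean value property of `|f|²` over hyperbolic discs. -/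
theorem enorm_sq_le_setLIntegral {u : ℂ → ℝ} (hu : AEStronglyMeasurable u area)
    (hu_pos : ∀ᵐ z ∂area, 0 < u z) {f : ℂ → ℂ} (hf : DifferentiableOn ℂ f disc) {a : ℂ}
    (ha : ‖a‖ < 1) :
    ‖f a‖ₑ ^ 2 ≤ ENNReal.ofReal (16 / (1 - ‖a‖) ^ 4) *
      dualArea u (Metric.ball a ((1 - ‖a‖) / 2)) *
      ∫⁻ z in Metric.ball a ((1 - ‖a‖) / 2), ‖f z‖ₑ ^ 2 ∂weightedArea u := by
  have hh : 0 < 1 - ‖a‖ := by linarith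
  have hsub : Metric.ball a ((1 - ‖a‖) / 2) ⊆ disc :=
    (Metric.ball_subset_ball (by linarith)).trans (ball_one_sub_norm_subset_disc a)
  have h1 := enorm_mul_le_lintegral_area (half_pos hh) hsub (hf.mono hsub)
  have h2 := sq_setLIntegral_area_le hu hu_pos (measurableSet_ball)
    ((hf.mono hsub).continuousOn.enorm.aemeasurable (μ := area) measurableSet_ball)
  have h3 := (pow_le_pow_left₀ zero_le h1 2).trans h2
  calc ‖f a‖ₑ ^ 2 = ENNReal.ofReal (16 / (1 - ‖a‖) ^ 4) *
        (‖f a‖ₑ * ENNReal.ofReal ((1 - ‖a‖) / 2) ^ 2) ^ 2 := by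
        rw [mul_pow, ← pow_mul, ← ENNReal.ofReal_pow (by positivity), mul_left_comm,
          ← ENNReal.ofReal_mul (by positivity)]
        have : 16 / (1 - ‖a‖) ^ 4 * ((1 - ‖a‖) / 2) ^ (2 * 2) = 1 := by
          field_simp
          ring
        rw [this, ENNReal.ofReal_one, mul_one]
    _ ≤ _ := by
        refine (mul_le_mul_right h3 _).trans_eq ?_
        ring

/-! ### From the Berezin bound to the Carleson inequality. -/

/-- The integral of `|B_z|²` controls the measure of the disc tangent to the circle about `z`. -/
theorem measure_ball_le_lintegral_bergmanKernel (ν : Measure ℂ) {z : ℂ} (hz : ‖z‖ < 1) :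
    ν (Metric.ball z (1 - ‖z‖)) ≤
      ENNReal.ofReal (81 * (1 - ‖z‖) ^ 4) * ∫⁻ w, ‖bergmanKernel z w‖ₑ ^ 2 ∂ν := by
  have hh : 0 < 1 - ‖z‖ := by linarith
  have hle : ENNReal.ofReal ((81 * (1 - ‖z‖) ^ 4)⁻¹) * ν (Metric.ball z (1 - ‖z‖)) ≤
      ∫⁻ w, ‖bergmanKernel z w‖ₑ ^ 2 ∂ν := by
    rw [← lintegral_indicator_const measurableSet_ball]
    refine lintegral_mono fun w => ?_
    refine Set.indicator_apply_le' (fun hw => ?_) fun _ => zero_le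
    have hw1 : ‖w‖ < 1 := by simpa [disc] using ball_one_sub_norm_subset_disc z hw
    rw [mem_ball_iff_norm] at hw
    rw [enorm_bergmanKernel_sq]
    have hpos : 0 < ‖1 - conj z * w‖ := hh.trans_le (one_sub_norm_le_norm_one_sub hw1.le)
    refine ENNReal.ofReal_le_ofReal (inv_anti₀ (by positivity) ?_)
    -- 1 - z̄w = (1 - |z|²) - z̄(w - z), where the terms are at most 2(1 - |z|) and 1 - |z|; hence
    -- 81 = 3⁴.
    have hup : ‖1 - conj z * w‖ ≤ 3 * (1 - ‖z‖) := by
      have : 1 - conj z * w = ((1 - ‖z‖ ^ 2 : ℝ) : ℂ) - conj z * (w - z) := by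
        push_cast
        rw [mul_sub, Complex.conj_mul']
        ring
      rw [this]
      refine (norm_sub_le _ _).trans ?_
      rw [Complex.norm_real, norm_mul, Complex.norm_conj,
        Real.norm_of_nonneg (by nlinarith [norm_nonneg z])]
      nlinarith [norm_nonneg z, norm_nonneg (w - z)]
    calc ‖1 - conj z * w‖ ^ 4 ≤ (3 * (1 - ‖z‖)) ^ 4 := by gcongr
      _ = _ := by ring
  refine le_trans (le_of_eq ?_) (mul_le_mul_right hle _)
  rw [← mul_assoc, ← ENNReal.ofReal_mul (by positivity), mul_inv_cancel₀ (by positivity),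
    ENNReal.ofReal_one, one_mul]

/-- For a `B₂` weight, a measure with bounded Berezin transform is a Carleson measure. -/
theorem isCarlesonMeasure_of_berezin_le {u : ℂ → ℝ} (hu_int : Integrable u area)
    (hu_pos : ∀ᵐ z ∂area, 0 < u z) (hu_B2 : BekolleBonami u) {ν : Measure ℂ} (hν : ν discᶜ = 0)
    {M : ℝ≥0} (hM : ∀ a ∈ disc, berezin u ν a ≤ M) : IsCarlesonMeasure u ν := by
  have hu := hu_int.aestronglyMeasurable
  have := isFiniteMeasure_weightedArea hu_int
  have := isFiniteMeasure_dualArea hu hu_pos hu_B2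
  obtain ⟨C, hC⟩ := exists_normSq_bergmanKernel_mul_dualArea_le hu_int hu_pos hu_B2
  have hdisc : MeasurableSet disc := measurableSet_ball
  have hber : ∀ a ∈ disc, ∫⁻ z, ‖bergmanKernel a z‖ₑ ^ 2 ∂ν ≤
      M * normSq u (bergmanKernel a) := by
    intro a ha
    have h := hM a ha
    rwa [berezin, ENNReal.div_le_iff_le_mul (Or.inr ENNReal.coe_ne_top)] at h
    -- Division by ∞ gives 0 in `ℝ≥0∞`, so an infinite kernel norm would void the Berezin bound; the
    -- duality estimate excludes it.
    refine Or.inl fun htop => ?_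
    have h1 := hC a ha
    have ha1 : ‖a‖ < 1 := by simpa [disc] using ha
    have h0 : dualArea u (Metric.ball a (2 * (1 - ‖a‖))) ≠ 0 := by
      intro h0
      have h2 := sq_area_le hu hu_pos (F := Metric.ball a (1 - ‖a‖)) measurableSet_ball
      rw [measure_mono_null (Metric.ball_subset_ball (by linarith)) h0, mul_zero,
        nonpos_iff_eq_zero, pow_eq_zero_iff two_ne_zero] at h2
      exact area_ball_ne_zero (ball_one_sub_norm_subset_disc a) (by linarith) h2
    rw [htop, ENNReal.top_mul h0] at h1
    exact absurd h1 (by simp)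
  have : IsFiniteMeasure ν := by
    -- B₀ = 1, so the bound at the origin makes ν finite, as needed for Tonelli.
    have h := hber 0 (by simp [disc])
    simp only [bergmanKernel, map_zero, zero_mul, sub_zero, one_pow, div_one, enorm_one,
      lintegral_const, one_mul, normSq] at h
    exact ⟨h.trans_lt (by finiteness)⟩
  have hνdisc : ∀ᵐ z ∂ν, z ∈ disc := by
    rw [ae_iff]; exact hν
  have hμdisc : ∀ᵐ z ∂weightedArea u, z ∈ disc := by
    rw [ae_iff]; exact weightedArea_compl_disc u
  refine ⟨6561 * M * C + 1, by positivity, fun f hf => ?_⟩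
  have hfd : DifferentiableOn ℂ f disc := hf.1.differentiableOn
  -- Nothing is known about f off 𝔻; cutting it off there secures measurability.
  set F : ℂ → ℝ≥0∞ := fun z => (disc.indicator (fun z => ‖f z‖ₑ) z) ^ 2 with hF
  have hFm : Measurable F := (measurable_indicator_enorm hdisc hfd.continuousOn).pow_const 2
  have hFd : ∀ z ∈ disc, F z = ‖f z‖ₑ ^ 2 := fun z hz => by
    simp only [hF, Set.indicator_of_mem hz]
  set G : ℂ → ℝ≥0∞ := fun a => ENNReal.ofReal (16 / (1 - ‖a‖) ^ 4) *
    dualArea u (Metric.ball a ((1 - ‖a‖) / 2)) with hG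
  set s : Set (ℂ × ℂ) := {p | ‖p.2 - p.1‖ < (1 - ‖p.1‖) / 2} with hs
  have hsm : MeasurableSet s := (isOpen_lt (by fun_prop) (by fun_prop)).measurableSet
  have hslice : ∀ a, Prod.mk a ⁻¹' s = Metric.ball a ((1 - ‖a‖) / 2) := by
    intro a
    ext z
    rw [mem_ball_iff_norm]
    rfl
  have hGm : Measurable G := by
    refine Measurable.mul (by fun_prop) ?_
    simp_rw [← hslice]
    exact measurable_measure_prodMk_left hsm
  set k : ℂ × ℂ → ℝ≥0∞ := s.indicator fun p => G p.1 * F p.2 with hk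
  have hkm : Measurable k :=
    ((hGm.comp measurable_fst).mul (hFm.comp measurable_snd)).indicator hsm
  have hpoint : ∀ a ∈ disc, ‖f a‖ₑ ^ 2 ≤ ∫⁻ z, k (a, z) ∂weightedArea u := by
    intro a ha
    have ha1 : ‖a‖ < 1 := by simpa [disc] using ha
    refine (enorm_sq_le_setLIntegral hu hu_pos hfd ha1).trans_eq ?_
    have hsub : Metric.ball a ((1 - ‖a‖) / 2) ⊆ disc :=
      (Metric.ball_subset_ball (by linarith)).trans (ball_one_sub_norm_subset_disc a)
    rw [setLIntegral_congr_fun (g := F) measurableSet_ball fun z hz => (hFd z (hsub hz)).symm,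
      ← lintegral_const_mul _ hFm, ← lintegral_indicator measurableSet_ball]
    refine lintegral_congr fun z => ?_
    have hiff : z ∈ Metric.ball a ((1 - ‖a‖) / 2) ↔ (a, z) ∈ s := by
      rw [← hslice a]
      rfl
    by_cases hz : z ∈ Metric.ball a ((1 - ‖a‖) / 2)
    · rw [Set.indicator_of_mem hz, hk, Set.indicator_of_mem (hiff.1 hz)]
    · rw [Set.indicator_of_notMem hz, hk, Set.indicator_of_notMem (mt hiff.2 hz)]
  have hinner : ∀ z ∈ disc, ∫⁻ a, k (a, z) ∂ν ≤ (6561 * M * C : ℝ≥0∞) * F z := by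
    intro z hz
    have hz1 : ‖z‖ < 1 := by simpa [disc] using hz
    have hh : 0 < 1 - ‖z‖ := by linarith
    -- The relation |z - a| < (1 - |a|)/2 gives 2/3 (1 - |z|) ≤ 1 - |a| ≤ 2(1 - |z|), so quantities
    -- at a are replaced by ones at z, with 81 = 16·(3/2)⁴.
    set Gz : ℝ≥0∞ := ENNReal.ofReal (81 / (1 - ‖z‖) ^ 4) *
      dualArea u (Metric.ball z (2 * (1 - ‖z‖))) with hGz
    have hle : ∀ a, k (a, z) ≤ (Metric.ball z (1 - ‖z‖)).indicator (fun _ => Gz * F z) a := by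
      intro a
      refine Set.indicator_apply_le' (s := s) (fun hmem => ?_) fun _ => zero_le
      have hza : ‖z - a‖ < (1 - ‖a‖) / 2 := hmem
      have t1 : ‖z‖ ≤ ‖z - a‖ + ‖a‖ := by simpa using norm_add_le (z - a) a
      have t2 : ‖a‖ ≤ ‖z - a‖ + ‖z‖ := by
        rw [norm_sub_rev]; simpa using norm_add_le (a - z) z
      rw [Set.indicator_of_mem]
      · gcongr
        refine mul_le_mul' (ENNReal.ofReal_le_ofReal ?_) (measure_mono ?_)
        · have t3 : 2 / 3 * (1 - ‖z‖) ≤ 1 - ‖a‖ := by linarith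
          have t4 : (2 / 3 * (1 - ‖z‖)) ^ 4 ≤ (1 - ‖a‖) ^ 4 := by gcongr
          have t5 : 0 < 1 - ‖a‖ := by linarith
          simp only
          rw [div_le_div_iff₀ (by positivity) (by positivity)]
          rw [mul_pow] at t4
          linarith
        · refine Metric.ball_subset_ball' ?_
          rw [dist_eq_norm, norm_sub_rev]
          simp only
          linarith
      · rw [mem_ball_iff_norm, norm_sub_rev]
        linarith
    calc ∫⁻ a, k (a, z) ∂ν ≤ Gz * F z * ν (Metric.ball z (1 - ‖z‖)) := by
          refine (lintegral_mono hle).trans_eq ?_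
          rw [lintegral_indicator_const measurableSet_ball]
      _ ≤ Gz * F z * (ENNReal.ofReal (81 * (1 - ‖z‖) ^ 4) *
            (M * normSq u (bergmanKernel z))) := by
          gcongr
          refine (measure_ball_le_lintegral_bergmanKernel ν hz1).trans ?_
          gcongr
          exact hber z hz
      _ = ENNReal.ofReal (81 / (1 - ‖z‖) ^ 4) * ENNReal.ofReal (81 * (1 - ‖z‖) ^ 4) * M *
            (normSq u (bergmanKernel z) * dualArea u (Metric.ball z (2 * (1 - ‖z‖)))) *
            F z := by
          rw [hGz]; ring
      _ ≤ ENNReal.ofReal (81 / (1 - ‖z‖) ^ 4) * ENNReal.ofReal (81 * (1 - ‖z‖) ^ 4) * M *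
            C * F z := by
          gcongr
          exact hC z hz
      _ = _ := by
          rw [← ENNReal.ofReal_mul (by positivity)]
          have : 81 / (1 - ‖z‖) ^ 4 * (81 * (1 - ‖z‖) ^ 4) = 6561 := by
            field_simp
            norm_num
          rw [this]
          norm_num
  calc ∫⁻ a, ‖f a‖ₑ ^ 2 ∂ν ≤ ∫⁻ a, ∫⁻ z, k (a, z) ∂weightedArea u ∂ν := by
        refine lintegral_mono_ae ?_
        filter_upwards [hνdisc] with a ha using hpoint a ha
    _ = ∫⁻ z, ∫⁻ a, k (a, z) ∂ν ∂weightedArea u :=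
        lintegral_lintegral_swap hkm.aemeasurable
    _ ≤ ∫⁻ z, (6561 * M * C : ℝ≥0∞) * F z ∂weightedArea u := by
        refine lintegral_mono_ae ?_
        filter_upwards [hμdisc] with z hz using hinner z hz
    _ = (6561 * M * C : ℝ≥0∞) * ∫⁻ z, ‖f z‖ₑ ^ 2 ∂weightedArea u := by
        rw [lintegral_const_mul _ hFm]
        congr 1
        refine lintegral_congr_ae ?_
        filter_upwards [hμdisc] with z hz using hFd z hz
    _ ≤ _ := by
        gcongr
        push_cast
        exact le_self_add

end WeightedBergman

theorem mainTheorem3 (u : ℂ → ℝ)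
    (hu_int : MeasureTheory.Integrable u WeightedBergman.area)
    (hu_pos : ∀ᵐ z ∂WeightedBergman.area, 0 < u z)
    (hu_B2 : WeightedBergman.BekolleBonami u)
    (ν : MeasureTheory.Measure ℂ) (hν : ν WeightedBergman.discᶜ = 0)
    (hbdd : ∃ M : NNReal, ∀ a ∈ WeightedBergman.disc, WeightedBergman.berezin u ν a ≤ M) :
    WeightedBergman.IsCarlesonMeasure u ν := by
  obtain ⟨M, hM⟩ := hbdd
  exact WeightedBergman.isCarlesonMeasure_of_berezin_le hu_int hu_pos hu_B2 hν hM
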